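/- Let $n\ge 2$, let $(\Omega,\mathcal F,\mathbb P)$ be a probability space, let $\mathcal F_0\subset\mathcal F_1\subset\dots\subset\mathcal F_n$ be sub-$\sigma$-fields of $\mathcal F$, and let $d_1,\dots,d_n\in\mathbb L^2$ be martingale differences, i.e. $d_k$ is $\mathcal F_k$-measurable and $\mathbb E(d_k\mid\mathcal F_{k-1})=0$ almost surely for $1\le k\le n$. Put $b_k^2=\mathbb E(d_k^2)$ and assume $\sum_{k=1}^n b_k^2=n$. Let $\theta=(\theta_1,\dots,\theta_n)$ be a random vector on $\Omega$, independent of $(\mathcal F_j)_{0\le j\le n}$ and uniformly distributed on the unit sphere of $\mathbb R^n$. Let $N_\theta$ be a random variable on $\Omega$ whose conditional distribution given $\theta$ is the normal distribution with mean $0$ and variance $\sum_{k=1}^n\theta_k^2b_k^2$, and let $N$ be a standard normal random variable. Let $\mathbb P_{|\theta}$ denote the (regular) conditional probability given $\theta$. Then $$\mathbb E\,\sup_{t\in\mathbb R}\bigl|\mathbb P_{|\theta}(N_\theta\le t)-\mathbb P(N\le t)\bigr|\;\le\;\frac{35\sqrt5}{4}\,\frac{\bigl(\sum_{k=1}^n(b_k^2-1)^2\bigr)^{1/2}}{n-1}.$$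 Moreover, there is an absolute constant $C>0$ (depending neither on $n$ nor on any of the objects above) such that, if in addition $d_1,\dots,d_n\in\mathbb L^4$ and $\alpha_n=\max_{1\le k\le n}\mathbb E(d_k^4)$, then $$\sup_{t\in\mathbb R}\bigl|\mathbb E\bigl(\mathbb P_{|\theta}(N_\theta\le t)\bigr)-\mathbb P(N\le t)\bigr|\;\le\; C\,\frac{1+\alpha_n(\log n)^2}{n}.$$ -/

import Mathlib

open MeasureTheory ProbabilityTheory

noncomputable section

/-- The Kolmogorov distance `sup_t |μ(-∞, t] - ν(-∞, t]|` between two laws on the line. -/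
def kolmogorovDist (μ ν : Measure ℝ) : ℝ :=
  ⨆ t : ℝ, |μ.real (Set.Iic t) - ν.real (Set.Iic t)|

/-- The uniform distribution on the unit sphere of `ℝⁿ` (normalized surface measure),
viewed as a measure on `ℝⁿ`. -/
def uniformSphere (n : ℕ) : Measure (EuclideanSpace ℝ (Fin n)) :=
  (((volume : Measure (EuclideanSpace ℝ (Fin n))).toSphere Set.univ)⁻¹ •
    (volume : Measure (EuclideanSpace ℝ (Fin n))).toSphere).map Subtype.val

variable {Ω : Type*} {mΩ : MeasurableSpace Ω}

/-- `(d 0, …, d (n-1))` is a vector of square integrable martingale differences with respect to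
the increasing σ-fields `ℱ 0 ⊆ ℱ 1 ⊆ … ⊆ ℱ n`, normalized by `∑ E (d k)² = n`.
The index `k : Fin n` stands for the `(k+1)`-st difference, so `d k` is `ℱ (k+1)`-measurable
and has conditional expectation zero given `ℱ k`. -/
structure IsNormalizedMartingaleDifference {n : ℕ} (d : Fin n → Ω → ℝ)
    (ℱ : Filtration (Fin (n + 1)) mΩ) (P : Measure Ω) : Prop where
  adapted : ∀ k, StronglyMeasurable[ℱ k.succ] (d k)
  memLp_two : ∀ k, MemLp (d k) 2 P
  condExp_eq_zero : ∀ k, P[d k | ℱ k.castSucc] =ᵐ[P] 0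
  sum_sq : ∑ k, ∫ ω, d k ω ^ 2 ∂P = n

/-- `θ` is a random vector, uniformly distributed on the unit sphere of `ℝⁿ` and independent of
the σ-fields `ℱ 0 ⊆ … ⊆ ℱ n`. -/
structure IsUniformDirection {n : ℕ} (θ : Ω → EuclideanSpace ℝ (Fin n))
    (ℱ : Filtration (Fin (n + 1)) mΩ) (P : Measure Ω) : Prop where
  measurable : Measurable θ
  law : P.map θ = uniformSphere n
  indep : Indep (MeasurableSpace.comap θ inferInstance) (⨆ j, ℱ j) P

/-- `Nθ` is a random variable which, conditionally on `θ`, is Gaussian with mean `0` and variance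
`∑ θ_k² E (d k)²` (a nonnegative number, so `Real.toNNReal` does not truncate). -/
structure IsConditionallyGaussian {n : ℕ} (Nθ : Ω → ℝ) (θ : Ω → EuclideanSpace ℝ (Fin n))
    (d : Fin n → Ω → ℝ) (P : Measure Ω) [IsFiniteMeasure P] : Prop where
  measurable : Measurable Nθ
  condDistrib_eq : ∀ᵐ ω ∂P, condDistrib Nθ θ P (θ ω) =
    gaussianReal 0 (∑ k, θ ω k ^ 2 * ∫ ω', d k ω' ^ 2 ∂P).toNNReal

/-- `α_n = sup_k E (d k)⁴`. -/
def maxFourthMoment {n : ℕ} (d : Fin n → Ω → ℝ) (P : Measure Ω) : ℝ :=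
  ⨆ k, ∫ ω, d k ω ^ 4 ∂P

end

/-!
Write `a k = E (d k)²` and `V = ∑ θ_k² a_k`. Conditionally on `θ` the law of `Nθ` is `N(0, V)`, so
only the law of `θ` and the numbers `a k`, with `∑ a k = n`, matter.

*Moments of `V`.* The uniform law on the sphere is invariant under reflections, which act
transitively on unit vectors; hence the moments of `⟨u, θ⟩` are the same for all unit vectors `u`
(`integral_inner_pow_uniformSphere`). Comparing the fourth moments along the coordinate axes and
along `(e_i ± e_j) / √2` gives `E θ_i⁴ = 3 E θ_i² θ_j²`, and `∑ θ_k² = 1` then fixes all second and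
fourth moments. Consequently `E V = 1` and `E (V - 1)² = 2 ∑ (a k - 1)² / (n (n + 2))`
(`integral_weighted_sum_sq_sq_uniformSphere`).

*Dependence on the variance.* For `v > 0` the distribution function of `N(0, v)` is `Φ(t / √v)`.
Since `|x| φ(x)` and `|x|³ φ(x)` are bounded, it differs from `Φ(t)` by at most `3 |v - 1|`, and from
its first-order expansion `Φ(t) - t φ(t) (v - 1) / 2` by at most `17 (v - 1)²`, uniformly in `t`
(`abs_gaussianReal_real_Iic_sub_le`, `abs_gaussianReal_real_Iic_sub_taylor_le`).

The first bound follows from the Lipschitz estimate and `E |V - 1| ≤ (E (V - 1)²)^{1/2}`. For the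
second, the first-order term vanishes on average because `E V = 1`, and
`∑ (a k - 1)² ≤ ∑ (a k)² ≤ n α_n`; as `(log n)² ≥ (log 2)²`, the resulting `O(α_n / n)` is within the
stated rate.
-/

/-! ### The standard normal distribution function -/

/-- The density of the standard normal law. -/
noncomputable def stdNormalPDF (x : ℝ) : ℝ := gaussianPDFReal 0 1 x

/-- The distribution function of the standard normal law. -/
noncomputable def stdNormalCDF (x : ℝ) : ℝ := (gaussianReal 0 1).real (Set.Iic x)

theorem stdNormalPDF_eq (x : ℝ) :
    stdNormalPDF x = (Real.sqrt (2 * Real.pi))⁻¹ * Real.exp (-(x ^ 2 / 2)) := by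
  simp [stdNormalPDF, gaussianPDFReal]
  left; ring

theorem stdNormalPDF_nonneg (x : ℝ) : 0 ≤ stdNormalPDF x := gaussianPDFReal_nonneg _ _ _

/-- A lower bound for `exp (x² / 2)` bounds the density from above; the factor `(2π)^{-1/2} ≤ 1` is
dropped. -/
theorem stdNormalPDF_le_inv {x c : ℝ} (hc : 0 < c) (h : c ≤ Real.exp (x ^ 2 / 2)) :
    stdNormalPDF x ≤ c⁻¹ := by
  rw [stdNormalPDF_eq, Real.exp_neg]
  have h1 : 1 ≤ Real.sqrt (2 * Real.pi) := by
    rw [Real.one_le_sqrt]; nlinarith [Real.pi_gt_three]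
  calc _ ≤ 1 * (Real.exp (x ^ 2 / 2))⁻¹ := by
        gcongr; exact inv_le_one_of_one_le₀ h1
    _ ≤ c⁻¹ := by rw [one_mul]; gcongr

theorem abs_mul_stdNormalPDF_le (x : ℝ) : |x| * stdNormalPDF x ≤ 1 := by
  have h := Real.add_one_le_exp (x ^ 2 / 2)
  have h2 : 0 < x ^ 2 / 2 + 1 := by positivity
  have := stdNormalPDF_le_inv (x := x) h2 (by linarith)
  calc _ ≤ |x| * (x ^ 2 / 2 + 1)⁻¹ := by gcongr
    _ ≤ 1 := by
      rw [← div_eq_mul_inv, div_le_one h2]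
      nlinarith [sq_nonneg (|x| - 1), sq_abs x]

theorem abs_cube_mul_stdNormalPDF_le (x : ℝ) : |x| ^ 3 * stdNormalPDF x ≤ 2 := by
  have h := Real.quadratic_le_exp_of_nonneg (x := x ^ 2 / 2) (by positivity)
  have h2 : 0 < 1 + x ^ 2 / 2 + (x ^ 2 / 2) ^ 2 / 2 := by positivity
  have := stdNormalPDF_le_inv (x := x) h2 (by linarith)
  calc _ ≤ |x| ^ 3 * (1 + x ^ 2 / 2 + (x ^ 2 / 2) ^ 2 / 2)⁻¹ := by gcongr
    _ ≤ 2 := by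
      rw [← div_eq_mul_inv, div_le_iff₀ h2, ← sq_abs x]
      nlinarith [sq_nonneg (|x| * (|x| - 2))]

theorem continuous_stdNormalPDF : Continuous stdNormalPDF := by
  simp only [funext stdNormalPDF_eq]
  fun_prop

theorem hasDerivAt_stdNormalPDF (x : ℝ) :
    HasDerivAt stdNormalPDF (-x * stdNormalPDF x) x := by
  simp only [funext stdNormalPDF_eq]
  have h : HasDerivAt (fun y : ℝ => -(y ^ 2 / 2)) (-x) x := by
    have := ((hasDerivAt_pow 2 x).div_const 2).neg
    convert! this using 1
    simp
  convert! (h.exp.const_mul (Real.sqrt (2 * Real.pi))⁻¹) using 1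
  ring

theorem stdNormalCDF_eq_integral (x : ℝ) :
    stdNormalCDF x = ∫ y in Set.Iic x, stdNormalPDF y := by
  rw [stdNormalCDF, measureReal_def, gaussianReal_apply_eq_integral _ one_ne_zero,
    ENNReal.toReal_ofReal]
  · rfl
  · exact integral_nonneg fun y => stdNormalPDF_nonneg y

theorem hasDerivAt_stdNormalCDF (x : ℝ) : HasDerivAt stdNormalCDF (stdNormalPDF x) x := by
  have hi : Integrable stdNormalPDF := integrable_gaussianPDFReal 0 1
  have h : stdNormalCDF = fun y => stdNormalCDF 0 + ∫ z in (0 : ℝ)..y, stdNormalPDF z := by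
    funext y
    rw [stdNormalCDF_eq_integral, stdNormalCDF_eq_integral,
      ← intervalIntegral.integral_Iic_sub_Iic hi.integrableOn hi.integrableOn]
    ring
  rw [h]
  exact (intervalIntegral.integral_hasDerivAt_right (hi.intervalIntegrable)
    continuous_stdNormalPDF.stronglyMeasurable.stronglyMeasurableAtFilter
    continuous_stdNormalPDF.continuousAt).const_add _

theorem continuous_stdNormalCDF : Continuous stdNormalCDF :=
  continuous_iff_continuousAt.2 fun x => (hasDerivAt_stdNormalCDF x).continuousAt

/-! ### Perturbing the variance of a centred normal law -/

theorem gaussianReal_zero_real_Iic {v : ℝ} (hv : 0 < v) (t : ℝ) :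
    (gaussianReal 0 v.toNNReal).real (Set.Iic t) = stdNormalCDF (t * (Real.sqrt v)⁻¹) := by
  have hs : 0 < Real.sqrt v := Real.sqrt_pos.2 hv
  have h := gaussianReal_map_const_mul (μ := 0) (v := 1) (Real.sqrt v)
  have h2 : (gaussianReal 0 v.toNNReal) =
      (gaussianReal 0 1).map (fun x => Real.sqrt v * x) := by
    rw [h]
    congr 1
    · simp
    · ext; simp [Real.sq_sqrt hv.le, hv.le]
  rw [h2, map_measureReal_apply (by fun_prop) measurableSet_Iic, stdNormalCDF]
  congr 1
  ext x
  simp only [Set.mem_preimage, Set.mem_Iic]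
  rw [← div_eq_mul_inv, le_div_iff₀ hs, mul_comm]

/-- The first `w`-derivative of `Φ(t w)` is bounded uniformly in `t`, because `|x| φ(x)` is
bounded. -/
theorem abs_stdNormalCDF_mul_sub_le {w : ℝ} (hw : 1 / 2 ≤ w) (t : ℝ) :
    |stdNormalCDF (t * w) - stdNormalCDF t| ≤ 2 * |w - 1| := by
  have hd : ∀ z ∈ Set.Ici (1 / 2 : ℝ), HasDerivWithinAt (fun z => stdNormalCDF (t * z))
      (stdNormalPDF (t * z) * t) (Set.Ici (1 / 2)) z := fun z _ => by
    have h1 : HasDerivAt (fun z : ℝ => t * z) t z := by simpa using (hasDerivAt_id z).const_mul t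
    exact ((hasDerivAt_stdNormalCDF (t * z)).comp z h1).hasDerivWithinAt
  have hb : ∀ z ∈ Set.Ici (1 / 2 : ℝ), ‖stdNormalPDF (t * z) * t‖ ≤ 2 := fun z hz => by
    have hz' : (1 / 2 : ℝ) ≤ z := hz
    have h := abs_mul_stdNormalPDF_le (t * z)
    rw [Real.norm_eq_abs, abs_mul, abs_of_nonneg (stdNormalPDF_nonneg _)]
    rw [abs_mul, abs_of_pos (by linarith : 0 < z)] at h
    nlinarith [mul_nonneg (stdNormalPDF_nonneg (t * z)) (abs_nonneg t)]
  have := (convex_Ici (1 / 2 : ℝ)).norm_image_sub_le_of_norm_hasDerivWithin_le hd hb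
    (x := 1) (y := w) (by norm_num) hw
  simpa using this

/-- The second `w`-derivative of `Φ(t w)` is bounded uniformly in `t`, because `|x|³ φ(x)` is
bounded. -/
theorem abs_stdNormalPDF_mul_sub_le {w : ℝ} (hw : 1 / 2 ≤ w) (t : ℝ) :
    |stdNormalPDF (t * w) * t - stdNormalPDF t * t| ≤ 8 * |w - 1| := by
  have hd : ∀ z ∈ Set.Ici (1 / 2 : ℝ), HasDerivWithinAt (fun z => stdNormalPDF (t * z) * t)
      (-(t * z) * stdNormalPDF (t * z) * t * t) (Set.Ici (1 / 2)) z := fun z _ => by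
    have h1 : HasDerivAt (fun z : ℝ => t * z) t z := by simpa using (hasDerivAt_id z).const_mul t
    exact (((hasDerivAt_stdNormalPDF (t * z)).comp z h1).mul_const t).hasDerivWithinAt
  have hb : ∀ z ∈ Set.Ici (1 / 2 : ℝ), ‖-(t * z) * stdNormalPDF (t * z) * t * t‖ ≤ 8 :=
    fun z hz => by
    have hz' : (1 / 2 : ℝ) ≤ z := hz
    have h := abs_cube_mul_stdNormalPDF_le (t * z)
    have hp := stdNormalPDF_nonneg (t * z)
    rw [Real.norm_eq_abs]
    simp only [abs_mul, abs_neg, abs_of_nonneg hp, abs_of_pos (by linarith : 0 < z)] at h ⊢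
    have h3 : 0 ≤ |t| ^ 3 * z * stdNormalPDF (t * z) := by positivity
    have h4 : |t| ^ 3 * z * stdNormalPDF (t * z) * (1 / 4) ≤
        |t| ^ 3 * z * stdNormalPDF (t * z) * z ^ 2 := by
      gcongr; nlinarith
    nlinarith
  have := (convex_Ici (1 / 2 : ℝ)).norm_image_sub_le_of_norm_hasDerivWithin_le hd hb
    (x := 1) (y := w) (by norm_num) hw
  simpa using this

theorem abs_stdNormalCDF_mul_sub_taylor_le {w : ℝ} (hw : 1 / 2 ≤ w) (t : ℝ) :
    |stdNormalCDF (t * w) - stdNormalCDF t - stdNormalPDF t * t * (w - 1)| ≤ 8 * (w - 1) ^ 2 := by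
  have hs : ∀ z ∈ Set.uIcc 1 w, 1 / 2 ≤ z ∧ |z - 1| ≤ |w - 1| := fun z hz => by
    refine ⟨?_, Set.abs_sub_left_of_mem_uIcc hz⟩
    exact (le_min (by norm_num) hw).trans hz.1
  have hd : ∀ z ∈ Set.uIcc 1 w,
      HasDerivWithinAt (fun z => stdNormalCDF (t * z) - stdNormalPDF t * t * z)
      (stdNormalPDF (t * z) * t - stdNormalPDF t * t) (Set.uIcc 1 w) z := fun z _ => by
    have h1 : HasDerivAt (fun z : ℝ => t * z) t z := by simpa using (hasDerivAt_id z).const_mul t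
    have h2 : HasDerivAt (fun z : ℝ => stdNormalPDF t * t * z) (stdNormalPDF t * t) z := by
      simpa using (hasDerivAt_id z).const_mul (stdNormalPDF t * t)
    exact (((hasDerivAt_stdNormalCDF (t * z)).comp z h1).sub h2).hasDerivWithinAt
  have hb : ∀ z ∈ Set.uIcc 1 w, ‖stdNormalPDF (t * z) * t - stdNormalPDF t * t‖ ≤ 8 * |w - 1| :=
    fun z hz => (abs_stdNormalPDF_mul_sub_le (hs z hz).1 t).trans (by linarith [(hs z hz).2])
  have := (convex_uIcc 1 w).norm_image_sub_le_of_norm_hasDerivWithin_le hd hb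
    (x := 1) (y := w) Set.left_mem_uIcc Set.right_mem_uIcc
  rw [Real.norm_eq_abs, Real.norm_eq_abs, mul_assoc (8 : ℝ), ← sq, sq_abs] at this
  convert! this using 2
  ring_nf

theorem abs_inv_sqrt_sub_one_le {v : ℝ} (hv : 1 / 4 ≤ v) :
    |(Real.sqrt v)⁻¹ - 1| ≤ 4 / 3 * |v - 1| := by
  have hr : 1 / 2 ≤ Real.sqrt v := Real.le_sqrt_of_sq_le (by norm_num; linarith)
  have hsq : Real.sqrt v ^ 2 = v := Real.sq_sqrt (by linarith)
  set r := Real.sqrt v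
  have hr0 : 0 < r := by linarith
  have h : v - 1 = -(r⁻¹ - 1) * (r * (r + 1)) := by rw [← hsq]; field_simp; ring
  rw [h, abs_mul, abs_neg, abs_of_pos (by positivity : 0 < r * (r + 1))]
  nlinarith [abs_nonneg (r⁻¹ - 1), mul_nonneg (abs_nonneg (r⁻¹ - 1))
    (by nlinarith : 0 ≤ r * (r + 1) - 3 / 4)]

theorem abs_inv_sqrt_sub_one_add_le {v : ℝ} (hv : 1 / 4 ≤ v) :
    |(Real.sqrt v)⁻¹ - 1 + (v - 1) / 2| ≤ 2 * (v - 1) ^ 2 := by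
  have hr : 1 / 2 ≤ Real.sqrt v := Real.le_sqrt_of_sq_le (by norm_num; linarith)
  have hsq : Real.sqrt v ^ 2 = v := Real.sq_sqrt (by linarith)
  set r := Real.sqrt v
  have hr0 : 0 < r := by linarith
  have h : r⁻¹ - 1 + (v - 1) / 2 = (r - 1) ^ 2 * ((r + 2) / (2 * r)) := by
    rw [← hsq]; field_simp; ring
  have h2 : 2 * (v - 1) ^ 2 = (r - 1) ^ 2 * (2 * (r + 1) ^ 2) := by rw [← hsq]; ring
  rw [h, h2, abs_of_nonneg (by positivity)]
  gcongr
  rw [div_le_iff₀ (by positivity)]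
  nlinarith [mul_nonneg (by linarith : 0 ≤ r - 1 / 2) hr0.le]

theorem inv_sqrt_ge_half {v : ℝ} (hv : 0 < v) (h4 : v ≤ 4) : 1 / 2 ≤ (Real.sqrt v)⁻¹ := by
  rw [one_div]
  gcongr
  · exact Real.sqrt_le_iff.2 ⟨by norm_num, by norm_num; exact h4⟩

theorem abs_measureReal_sub_le_one (μ ν : Measure ℝ) [IsProbabilityMeasure μ]
    [IsProbabilityMeasure ν] (s : Set ℝ) : |μ.real s - ν.real s| ≤ 1 := by
  rw [abs_le]
  constructor <;> linarith [measureReal_nonneg (μ := μ) (s := s),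
    measureReal_le_one (μ := μ) (s := s), measureReal_nonneg (μ := ν) (s := s),
    measureReal_le_one (μ := ν) (s := s)]

theorem abs_gaussianReal_real_Iic_sub_le (v t : ℝ) :
    |(gaussianReal 0 v.toNNReal).real (Set.Iic t) - (gaussianReal 0 1).real (Set.Iic t)| ≤
      3 * |v - 1| := by
  by_cases h : 1 / 4 ≤ v ∧ v ≤ 4
  · have hv : 0 < v := by linarith
    rw [gaussianReal_zero_real_Iic hv]
    have h1 := abs_stdNormalCDF_mul_sub_le (inv_sqrt_ge_half hv h.2) t
    have h2 := abs_inv_sqrt_sub_one_le h.1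
    refine h1.trans ?_
    linarith [abs_nonneg (v - 1)]
  · -- away from variance `1` both sides are compared with the trivial bound `1`
    have h1 : 3 / 4 ≤ |v - 1| := by
      rw [le_abs]
      by_contra! hc
      exact h ⟨by linarith, by linarith⟩
    have := abs_measureReal_sub_le_one (gaussianReal 0 v.toNNReal) (gaussianReal 0 1) (Set.Iic t)
    linarith

theorem abs_gaussianReal_real_Iic_sub_taylor_le (v t : ℝ) :
    |(gaussianReal 0 v.toNNReal).real (Set.Iic t) - (gaussianReal 0 1).real (Set.Iic t) +
      stdNormalPDF t * t / 2 * (v - 1)| ≤ 17 * (v - 1) ^ 2 := by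
  have hm : |stdNormalPDF t * t| ≤ 1 := by
    rw [abs_mul, abs_of_nonneg (stdNormalPDF_nonneg _), mul_comm]
    exact abs_mul_stdNormalPDF_le t
  by_cases h : 1 / 4 ≤ v ∧ v ≤ 4
  · have hv : 0 < v := by linarith
    rw [gaussianReal_zero_real_Iic hv]
    have h1 := abs_stdNormalCDF_mul_sub_taylor_le (inv_sqrt_ge_half hv h.2) t
    have h2 := abs_inv_sqrt_sub_one_le h.1
    have h3 := abs_inv_sqrt_sub_one_add_le h.1
    change |stdNormalCDF _ - stdNormalCDF t + _| ≤ _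
    set w := (Real.sqrt v)⁻¹
    have h4 : (w - 1) ^ 2 ≤ (4 / 3 * |v - 1|) ^ 2 := by
      rw [← sq_abs]; gcongr
    rw [mul_pow, sq_abs] at h4
    have h5 : |stdNormalPDF t * t * (w - 1 + (v - 1) / 2)| ≤ 2 * (v - 1) ^ 2 := by
      rw [abs_mul]
      exact (mul_le_of_le_one_left (abs_nonneg _) hm).trans h3
    calc _ = |(stdNormalCDF (t * w) - stdNormalCDF t - stdNormalPDF t * t * (w - 1)) +
          stdNormalPDF t * t * (w - 1 + (v - 1) / 2)| := by ring_nf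
      _ ≤ _ := abs_add_le _ _
      _ ≤ _ := by nlinarith [sq_nonneg (v - 1)]
  · have h1 : 3 / 4 ≤ |v - 1| := by
      rw [le_abs]
      by_contra! hc
      exact h ⟨by linarith, by linarith⟩
    have h2 := abs_measureReal_sub_le_one (gaussianReal 0 v.toNNReal) (gaussianReal 0 1) (Set.Iic t)
    have h3 : |stdNormalPDF t * t / 2 * (v - 1)| ≤ |v - 1| / 2 := by
      rw [abs_mul, abs_div, abs_of_pos (two_pos : (0 : ℝ) < 2)]
      nlinarith [abs_nonneg (v - 1)]
    refine (abs_add_le _ _).trans ?_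
    rw [← sq_abs (v - 1)]
    nlinarith

theorem kolmogorovDist_nonneg (μ ν : Measure ℝ) : 0 ≤ kolmogorovDist μ ν :=
  Real.iSup_nonneg fun _ => abs_nonneg _

theorem kolmogorovDist_gaussianReal_le (v : ℝ) :
    kolmogorovDist (gaussianReal 0 v.toNNReal) (gaussianReal 0 1) ≤ 3 * |v - 1| :=
  ciSup_le fun t => abs_gaussianReal_real_Iic_sub_le v t

/-! ### Measurability in the variance -/

theorem measurable_gaussianReal_real_Iic (t : ℝ) :
    Measurable fun v : ℝ => (gaussianReal 0 v.toNNReal).real (Set.Iic t) := by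
  have h : (fun v : ℝ => (gaussianReal 0 v.toNNReal).real (Set.Iic t)) = fun v : ℝ =>
      if v ≤ 0 then (gaussianReal 0 0).real (Set.Iic t)
        else stdNormalCDF (t * (Real.sqrt v)⁻¹) := by
    funext v
    split_ifs with hv
    · rw [Real.toNNReal_of_nonpos hv]
    · exact gaussianReal_zero_real_Iic (not_le.1 hv) t
  rw [h]
  refine Measurable.ite measurableSet_Iic measurable_const ?_
  exact continuous_stdNormalCDF.measurable.comp (by fun_prop)

/-- As a function of `w = v^{-1/2}` the distance is a supremum of continuous functions, hence lower
semicontinuous; this takes care of the uncountable supremum. The variances `v ≤ 0` all give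
the same Dirac mass. -/
theorem measurable_kolmogorovDist_gaussianReal :
    Measurable fun v : ℝ => kolmogorovDist (gaussianReal 0 v.toNNReal) (gaussianReal 0 1) := by
  have h : (fun v : ℝ => kolmogorovDist (gaussianReal 0 v.toNNReal) (gaussianReal 0 1)) =
      fun v : ℝ => if v ≤ 0 then kolmogorovDist (gaussianReal 0 0) (gaussianReal 0 1)
        else (fun w : ℝ => ⨆ t : ℝ, |stdNormalCDF (t * w) - stdNormalCDF t|)
          (Real.sqrt v)⁻¹ := by
    funext v
    split_ifs with hv
    · rw [Real.toNNReal_of_nonpos hv]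
    · simp only [kolmogorovDist, gaussianReal_zero_real_Iic (not_le.1 hv), stdNormalCDF]
  rw [h]
  refine Measurable.ite measurableSet_Iic measurable_const ?_
  have hw : Measurable fun w : ℝ => ⨆ t : ℝ, |stdNormalCDF (t * w) - stdNormalCDF t| := by
    refine LowerSemicontinuous.measurable ?_
    refine lowerSemicontinuous_ciSup (fun w => ⟨1, ?_⟩) fun t => ?_
    · rintro _ ⟨t, rfl⟩
      rw [abs_le]
      have h0 : ∀ x, 0 ≤ stdNormalCDF x := fun x => measureReal_nonneg
      have h1 : ∀ x, stdNormalCDF x ≤ 1 := fun x => measureReal_le_one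
      constructor <;> linarith [h0 (t * w), h0 t, h1 (t * w), h1 t]
    · have := continuous_stdNormalCDF
      exact Continuous.lowerSemicontinuous (by fun_prop)
  exact hw.comp (f := fun v : ℝ => (Real.sqrt v)⁻¹) (by fun_prop)

/-! ### Moments of the uniform distribution on the sphere -/

open scoped Pointwise in
/-- A linear isometry carries the cone `(0, 1) • s` over a subset `s` of the sphere to the cone over
its image, and preserves volume. -/
theorem toSphere_preimage_linearIsometryEquiv {n : ℕ}
    (R : EuclideanSpace ℝ (Fin n) ≃ₗᵢ[ℝ] EuclideanSpace ℝ (Fin n))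
    {s : Set (EuclideanSpace ℝ (Fin n))} (hs : MeasurableSet s) :
    (volume : Measure (EuclideanSpace ℝ (Fin n))).toSphere (Subtype.val ⁻¹' (R ⁻¹' s)) =
      (volume : Measure (EuclideanSpace ℝ (Fin n))).toSphere (Subtype.val ⁻¹' s) := by
  have hR : Measurable R := R.continuous.measurable
  rw [Measure.toSphere_apply' _ (measurable_subtype_coe (hR hs)),
    Measure.toSphere_apply' _ (measurable_subtype_coe hs)]
  congr 1
  conv_rhs => rw [← R.measurePreserving.measure_preimage_equiv (f := R.toMeasurableEquiv)]
  congr 1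
  have hcoe : (R.toMeasurableEquiv : EuclideanSpace ℝ (Fin n) → EuclideanSpace ℝ (Fin n)) = R := rfl
  rw [hcoe]
  ext x
  simp only [Subtype.image_preimage_coe, Set.mem_preimage, Set.mem_smul, Set.mem_inter_iff,
    mem_sphere_zero_iff_norm]
  constructor
  · rintro ⟨r, hr, y, ⟨hy, hys⟩, rfl⟩
    exact ⟨r, hr, R y, ⟨by simpa using hy, hys⟩, by simp⟩
  · rintro ⟨r, hr, y, ⟨hy, hys⟩, hxy⟩
    refine ⟨r, hr, R.symm y, ⟨by simpa using hy, by simpa using hys⟩, ?_⟩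
    rw [← map_smul, hxy, R.symm_apply_apply]

theorem uniformSphere_map_linearIsometryEquiv {n : ℕ}
    (R : EuclideanSpace ℝ (Fin n) ≃ₗᵢ[ℝ] EuclideanSpace ℝ (Fin n)) :
    (uniformSphere n).map R = uniformSphere n := by
  have hR : Measurable R := R.continuous.measurable
  ext s hs
  rw [Measure.map_apply hR hs, uniformSphere, Measure.map_apply measurable_subtype_coe (hR hs),
    Measure.map_apply measurable_subtype_coe hs, Measure.smul_apply, Measure.smul_apply,
    toSphere_preimage_linearIsometryEquiv R hs]

theorem isProbabilityMeasure_uniformSphere {n : ℕ} (hn : n ≠ 0) :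
    IsProbabilityMeasure (uniformSphere n) := by
  have : NeZero n := ⟨hn⟩
  have h : (volume : Measure (EuclideanSpace ℝ (Fin n))).toSphere Set.univ ≠ 0 := by
    simpa only [ne_eq, Measure.measure_univ_eq_zero, Measure.toSphere_eq_zero_iff_finrank,
      finrank_euclideanSpace_fin] using hn
  refine ⟨?_⟩
  rw [uniformSphere, Measure.map_apply measurable_subtype_coe MeasurableSet.univ]
  simp only [Set.preimage_univ, Measure.smul_apply, smul_eq_mul]
  exact ENNReal.inv_mul_cancel h (measure_ne_top _ _)

theorem ae_uniformSphere_norm_eq_one (n : ℕ) : ∀ᵐ x ∂uniformSphere n, ‖x‖ = 1 := by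
  rw [uniformSphere, ae_map_iff measurable_subtype_coe.aemeasurable
    (measurableSet_eq_fun measurable_norm measurable_const)]
  exact Filter.Eventually.of_forall fun x => by simp

theorem ae_uniformSphere_sum_sq (n : ℕ) : ∀ᵐ x ∂uniformSphere n, ∑ k, x k ^ 2 = 1 := by
  filter_upwards [ae_uniformSphere_norm_eq_one n] with x hx
  rw [← EuclideanSpace.real_norm_sq_eq, hx, one_pow]

/-- A reflection carries any unit vector to any other, so the moments of a linear functional
depend only on its norm. -/
theorem integral_inner_pow_uniformSphere {n : ℕ} {u w : EuclideanSpace ℝ (Fin n)}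
    (h : ‖u‖ = ‖w‖) (p : ℕ) :
    ∫ x, (inner ℝ u x) ^ p ∂uniformSphere n = ∫ x, (inner ℝ w x) ^ p ∂uniformSphere n := by
  set R := (ℝ ∙ (u - w))ᗮ.reflection
  have hRu : R u = w := Submodule.reflection_sub h
  conv_rhs => rw [← uniformSphere_map_linearIsometryEquiv R]
  rw [integral_map R.continuous.measurable.aemeasurable
    (Continuous.aestronglyMeasurable (by fun_prop))]
  simp_rw [← hRu, LinearIsometryEquiv.inner_map_map]

theorem integrable_uniformSphere_of_continuous {n : ℕ} (hn : n ≠ 0)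
    {f : EuclideanSpace ℝ (Fin n) → ℝ} (hf : Continuous f) :
    Integrable f (uniformSphere n) := by
  have := isProbabilityMeasure_uniformSphere hn
  obtain ⟨C, hC⟩ := (isCompact_sphere (0 : EuclideanSpace ℝ (Fin n)) 1).exists_bound_of_continuousOn
    hf.continuousOn
  refine Integrable.of_bound hf.aestronglyMeasurable C ?_
  filter_upwards [ae_uniformSphere_norm_eq_one n] with x hx
  exact hC x (by simpa using hx)

theorem integral_coord_pow_uniformSphere {n : ℕ} (i j : Fin n) (p : ℕ) :
    ∫ x, x i ^ p ∂uniformSphere n = ∫ x, x j ^ p ∂uniformSphere n := by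
  have := integral_inner_pow_uniformSphere (u := EuclideanSpace.single i (1 : ℝ))
    (w := EuclideanSpace.single j (1 : ℝ)) (by simp) p
  simpa only [EuclideanSpace.inner_single_left, map_one, one_mul] using this

theorem integral_sq_uniformSphere {n : ℕ} (hn : n ≠ 0) (i : Fin n) :
    ∫ x, x i ^ 2 ∂uniformSphere n = 1 / n := by
  have := isProbabilityMeasure_uniformSphere hn
  have hij : ∀ j, ∫ x, x j ^ 2 ∂uniformSphere n = ∫ x, x i ^ 2 ∂uniformSphere n :=
    fun j => integral_coord_pow_uniformSphere j i 2
  have h1 : ∫ x, ∑ k, x k ^ 2 ∂uniformSphere n = 1 := by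
    rw [integral_congr_ae (ae_uniformSphere_sum_sq n)]; simp
  rw [integral_finsetSum _ fun k _ => integrable_uniformSphere_of_continuous hn (by fun_prop)] at h1
  simp only [hij, Finset.sum_const, Finset.card_univ, Fintype.card_fin, nsmul_eq_mul] at h1
  have : (n : ℝ) ≠ 0 := by exact_mod_cast hn
  field_simp
  linarith

/-- Polarization: `(x + y)⁴ + (x - y)⁴ = 2x⁴ + 12x²y² + 2y⁴`, and the four linear functionals
`x`, `y`, `(x ± y) / √2` have the same fourth moment. -/
theorem integral_sq_mul_sq_uniformSphere {n : ℕ} (hn : n ≠ 0) {i j : Fin n} (hij : i ≠ j) :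
    3 * ∫ x, x i ^ 2 * x j ^ 2 ∂uniformSphere n = ∫ x, x i ^ 4 ∂uniformSphere n := by
  have key : ∀ u : EuclideanSpace ℝ (Fin n), ‖u‖ = √2 →
      ∫ x, (inner ℝ u x) ^ 4 ∂uniformSphere n = 4 * ∫ x, x i ^ 4 ∂uniformSphere n := by
    intro u hu
    rw [integral_inner_pow_uniformSphere (w := EuclideanSpace.single i (√2))
      (by simp [hu, abs_of_nonneg]),
      ← integral_const_mul]
    congr 1 with x
    have : √2 ^ 4 = (4 : ℝ) := by
      rw [show (4 : ℕ) = 2 * 2 by norm_num, pow_mul, Real.sq_sqrt two_pos.le]; norm_num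
    rw [EuclideanSpace.inner_single_left, mul_pow]
    simp [this]
  have hj : ∫ x, x j ^ 4 ∂uniformSphere n = ∫ x, x i ^ 4 ∂uniformSphere n :=
    integral_coord_pow_uniformSphere j i 4
  have hn2 : ∀ s : ℝ, s ^ 2 = 1 →
      ‖EuclideanSpace.single i (1 : ℝ) + EuclideanSpace.single j s‖ = √2 := fun s hs => by
    rw [← Real.sqrt_sq (norm_nonneg _)]
    congr 1
    rw [norm_add_sq_real]
    simp [EuclideanSpace.inner_single_left, hij, hs]
    norm_num
  have hp := key _ (hn2 1 (by norm_num))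
  have hm := key _ (hn2 (-1) (by norm_num))
  simp only [inner_add_left, EuclideanSpace.inner_single_left, map_one, one_mul, map_neg,
    neg_mul] at hp hm
  have hI : ∀ {f : EuclideanSpace ℝ (Fin n) → ℝ}, Continuous f → Integrable f (uniformSphere n) :=
    fun hf => integrable_uniformSphere_of_continuous hn hf
  have hsum : ∫ x, (x i + x j) ^ 4 ∂uniformSphere n + ∫ x, (x i + -x j) ^ 4 ∂uniformSphere n =
      2 * ∫ x, x i ^ 4 ∂uniformSphere n + 12 * ∫ x, x i ^ 2 * x j ^ 2 ∂uniformSphere n +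
        2 * ∫ x, x j ^ 4 ∂uniformSphere n := by
    rw [← integral_add (hI (by fun_prop)) (hI (by fun_prop)), ← integral_const_mul,
      ← integral_const_mul, ← integral_const_mul,
      ← integral_add (hI (by fun_prop)) (hI (by fun_prop)),
      ← integral_add (hI (by fun_prop)) (hI (by fun_prop))]
    congr 1 with x
    ring
  linarith

theorem integral_sum_sum_sq_mul_sq_uniformSphere {n : ℕ} (hn : n ≠ 0) (c : Fin n → Fin n → ℝ) :
    ∫ x, (∑ k, ∑ l, x k ^ 2 * x l ^ 2 * c k l) ∂uniformSphere n =
      ∑ k, ∑ l, (∫ x, x k ^ 2 * x l ^ 2 ∂uniformSphere n) * c k l := by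
  rw [integral_finsetSum _ fun k _ =>
    integrable_uniformSphere_of_continuous hn (by fun_prop)]
  refine Finset.sum_congr rfl fun k _ => ?_
  rw [integral_finsetSum _ fun l _ =>
    integrable_uniformSphere_of_continuous hn (by fun_prop)]
  exact Finset.sum_congr rfl fun l _ => integral_mul_const _ _

theorem integral_sq_mul_sq_uniformSphere_eq {n : ℕ} (hn : n ≠ 0) (i j : Fin n) :
    ∫ x, x i ^ 2 * x j ^ 2 ∂uniformSphere n =
      (1 + if i = j then 2 else 0) / (n * (n + 2)) := by
  have := isProbabilityMeasure_uniformSphere hn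
  have hn0 : (n : ℝ) ≠ 0 := by exact_mod_cast hn
  set A := ∫ x, x i ^ 4 ∂uniformSphere n with hA
  have hk : ∀ k, ∫ x, x k ^ 4 ∂uniformSphere n = A :=
    fun k => integral_coord_pow_uniformSphere k i 4
  have h : ∀ k l : Fin n, ∫ x, x k ^ 2 * x l ^ 2 ∂uniformSphere n =
      A / 3 * (1 + if k = l then 2 else 0) := fun k l => by
    split_ifs with hkl
    · subst hkl
      simp_rw [← pow_add]
      rw [hk]; ring
    · have := integral_sq_mul_sq_uniformSphere hn hkl
      rw [hk] at this
      linarith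
  have h1 : ∫ x, (∑ k, ∑ l, x k ^ 2 * x l ^ 2 * 1) ∂uniformSphere n = 1 := by
    have : ∀ᵐ x ∂uniformSphere n, ∑ k, ∑ l, x k ^ 2 * x l ^ 2 * 1 = 1 := by
      filter_upwards [ae_uniformSphere_sum_sq n] with x hx
      simp_rw [mul_one, ← Finset.mul_sum, ← Finset.sum_mul, hx, one_mul]
    rw [integral_congr_ae this]; simp
  rw [integral_sum_sum_sq_mul_sq_uniformSphere hn fun _ _ => 1] at h1
  simp_rw [h, mul_one, ← Finset.mul_sum, Finset.sum_add_distrib] at h1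
  simp at h1
  have hA' : A / 3 = 1 / (n * (n + 2)) := by
    rw [eq_div_iff (by positivity)]
    linarith
  rw [h, hA']
  ring

theorem integral_weighted_sum_sq_uniformSphere {n : ℕ} (hn : n ≠ 0) (c : Fin n → ℝ) :
    ∫ x, (∑ k, x k ^ 2 * c k) ∂uniformSphere n = (∑ k, c k) / n := by
  rw [integral_finsetSum _ fun k _ =>
    integrable_uniformSphere_of_continuous hn (by fun_prop)]
  simp_rw [integral_mul_const, integral_sq_uniformSphere hn, ← Finset.mul_sum]
  ring

theorem integral_weighted_sum_sq_sq_uniformSphere {n : ℕ} (hn : n ≠ 0) {c : Fin n → ℝ}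
    (hc : ∑ k, c k = 0) :
    ∫ x, (∑ k, x k ^ 2 * c k) ^ 2 ∂uniformSphere n = 2 * (∑ k, c k ^ 2) / (n * (n + 2)) := by
  have h : ∀ x : EuclideanSpace ℝ (Fin n), (∑ k, x k ^ 2 * c k) ^ 2 =
      ∑ k, ∑ l, x k ^ 2 * x l ^ 2 * (c k * c l) := fun x => by
    rw [sq, Finset.sum_mul_sum]
    refine Finset.sum_congr rfl fun k _ => Finset.sum_congr rfl fun l _ => by ring
  simp_rw [h]
  rw [integral_sum_sum_sq_mul_sq_uniformSphere hn fun k l => c k * c l]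
  simp_rw [integral_sq_mul_sq_uniformSphere_eq hn, add_div, add_mul, Finset.sum_add_distrib]
  have h0 : ∑ k, ∑ l, 1 / ((n : ℝ) * (n + 2)) * (c k * c l) = 0 := by
    simp_rw [← Finset.mul_sum, hc]; simp
  rw [h0, zero_add]
  simp only [ite_div, ite_mul, zero_div, zero_mul, Finset.sum_ite_eq, Finset.mem_univ, if_true,
    ← Finset.mul_sum]
  simp_rw [sq]
  ring

/-! ### Random directions and conditionally Gaussian variables -/

section RandomDirection

variable {Ω : Type*} {mΩ : MeasurableSpace Ω} {P : Measure Ω} {n : ℕ}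
  {θ : Ω → EuclideanSpace ℝ (Fin n)} {a : Fin n → ℝ}

theorem sum_sq_mul_sub_one {x : EuclideanSpace ℝ (Fin n)} (hx : ∑ k, x k ^ 2 = 1) :
    ∑ k, x k ^ 2 * a k - 1 = ∑ k, x k ^ 2 * (a k - 1) := by
  simp_rw [mul_sub, mul_one, Finset.sum_sub_distrib, hx]

theorem ae_sum_sq_mul_sub_one (hθ : Measurable θ) (hlaw : P.map θ = uniformSphere n) :
    ∀ᵐ ω ∂P, ∑ k, θ ω k ^ 2 * a k - 1 = ∑ k, θ ω k ^ 2 * (a k - 1) := by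
  have h := ae_uniformSphere_sum_sq n
  rw [← hlaw] at h
  filter_upwards [ae_of_ae_map hθ.aemeasurable h] with ω hω
  exact sum_sq_mul_sub_one hω

theorem integrable_comp_uniformDirection (hn : n ≠ 0) (hθ : Measurable θ)
    (hlaw : P.map θ = uniformSphere n) {f : EuclideanSpace ℝ (Fin n) → ℝ} (hf : Continuous f) :
    Integrable (fun ω => f (θ ω)) P := by
  have h := integrable_uniformSphere_of_continuous hn hf
  rw [← hlaw] at h
  exact h.comp_measurable hθ

theorem integral_comp_uniformDirection (hθ : Measurable θ)
    (hlaw : P.map θ = uniformSphere n) {f : EuclideanSpace ℝ (Fin n) → ℝ} (hf : Continuous f) :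
    ∫ ω, f (θ ω) ∂P = ∫ x, f x ∂uniformSphere n := by
  rw [← hlaw, integral_map hθ.aemeasurable hf.aestronglyMeasurable]

theorem integral_sum_sq_mul_sub_one (hn : n ≠ 0) (hθ : Measurable θ)
    (hlaw : P.map θ = uniformSphere n) (ha : ∑ k, a k = n) :
    ∫ ω, (∑ k, θ ω k ^ 2 * a k - 1) ∂P = 0 := by
  rw [integral_congr_ae (ae_sum_sq_mul_sub_one hθ hlaw),
    integral_comp_uniformDirection (f := fun x => ∑ k, x k ^ 2 * (a k - 1)) hθ hlaw (by fun_prop),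
    integral_weighted_sum_sq_uniformSphere hn]
  simp [ha]

theorem integral_sum_sq_mul_sub_one_sq (hn : n ≠ 0) (hθ : Measurable θ)
    (hlaw : P.map θ = uniformSphere n) (ha : ∑ k, a k = n) :
    ∫ ω, (∑ k, θ ω k ^ 2 * a k - 1) ^ 2 ∂P =
      2 * (∑ k, (a k - 1) ^ 2) / ((n : ℝ) * (n + 2)) := by
  have h : ∀ᵐ ω ∂P, (∑ k, θ ω k ^ 2 * a k - 1) ^ 2 = (∑ k, θ ω k ^ 2 * (a k - 1)) ^ 2 := by
    filter_upwards [ae_sum_sq_mul_sub_one (a := a) hθ hlaw] with ω hω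
    rw [hω]
  rw [integral_congr_ae h,
    integral_comp_uniformDirection (f := fun x => (∑ k, x k ^ 2 * (a k - 1)) ^ 2) hθ hlaw
      (by fun_prop),
    integral_weighted_sum_sq_sq_uniformSphere hn (by simp [ha])]

theorem integral_abs_le_sqrt_integral_sq [IsProbabilityMeasure P] {X : Ω → ℝ}
    (hX : MemLp X 2 P) : ∫ ω, |X ω| ∂P ≤ Real.sqrt (∫ ω, X ω ^ 2 ∂P) := by
  apply Real.le_sqrt_of_sq_le
  have h := variance_nonneg (fun ω => |X ω|) P
  rw [variance_eq_sub (X := fun ω => |X ω|) hX.norm] at h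
  simp only [Pi.pow_apply, sq_abs] at h
  linarith

theorem integral_kolmogorovDist_gaussianReal_le [IsProbabilityMeasure P] (hn : 2 ≤ n)
    (hθ : Measurable θ) (hlaw : P.map θ = uniformSphere n) (ha : ∑ k, a k = n) :
    Integrable (fun ω => kolmogorovDist (gaussianReal 0 (∑ k, θ ω k ^ 2 * a k).toNNReal)
        (gaussianReal 0 1)) P ∧
      ∫ ω, kolmogorovDist (gaussianReal 0 (∑ k, θ ω k ^ 2 * a k).toNNReal)
        (gaussianReal 0 1) ∂P ≤
          35 * Real.sqrt 5 / 4 * (Real.sqrt (∑ k, (a k - 1) ^ 2) / ((n : ℝ) - 1)) := by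
  have hn0 : n ≠ 0 := by omega
  have hn2 : (2 : ℝ) ≤ n := by exact_mod_cast hn
  have hVm : Measurable fun ω => ∑ k, θ ω k ^ 2 * a k :=
    (Continuous.measurable (by fun_prop : Continuous
      fun x : EuclideanSpace ℝ (Fin n) => ∑ k, x k ^ 2 * a k)).comp hθ
  have hI : Integrable (fun ω => 3 * |∑ k, θ ω k ^ 2 * a k - 1|) P :=
    integrable_comp_uniformDirection (f := fun x => 3 * |∑ k, x k ^ 2 * a k - 1|) hn0 hθ hlaw
      (by fun_prop)
  have hK : Integrable (fun ω => kolmogorovDist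
      (gaussianReal 0 (∑ k, θ ω k ^ 2 * a k).toNNReal) (gaussianReal 0 1)) P := by
    refine hI.mono' (measurable_kolmogorovDist_gaussianReal.comp hVm).aestronglyMeasurable
      (Filter.Eventually.of_forall fun ω => ?_)
    rw [Real.norm_eq_abs, abs_of_nonneg (kolmogorovDist_nonneg _ _)]
    exact kolmogorovDist_gaussianReal_le _
  refine ⟨hK, ?_⟩
  have hL2 : MemLp (fun ω => ∑ k, θ ω k ^ 2 * a k - 1) 2 P := by
    rw [memLp_two_iff_integrable_sq (hVm.sub_const 1).aestronglyMeasurable]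
    exact integrable_comp_uniformDirection (f := fun x => (∑ k, x k ^ 2 * a k - 1) ^ 2)
      hn0 hθ hlaw (by fun_prop)
  have h5 : 2 ≤ Real.sqrt 5 := Real.le_sqrt_of_sq_le (by norm_num)
  calc _ ≤ ∫ ω, 3 * |∑ k, θ ω k ^ 2 * a k - 1| ∂P :=
        integral_mono hK hI fun ω => kolmogorovDist_gaussianReal_le _
    _ ≤ 3 * Real.sqrt (2 * (∑ k, (a k - 1) ^ 2) / (n * (n + 2))) := by
        rw [integral_const_mul, ← integral_sum_sq_mul_sub_one_sq hn0 hθ hlaw ha]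
        gcongr
        exact integral_abs_le_sqrt_integral_sq hL2
    _ ≤ 3 * (2 * (Real.sqrt (∑ k, (a k - 1) ^ 2) / ((n : ℝ) - 1))) := by
        gcongr
        have h1 : 0 < (n : ℝ) - 1 := by linarith
        have hS : 0 ≤ ∑ k, (a k - 1) ^ 2 := Finset.sum_nonneg fun k _ => sq_nonneg _
        refine Real.sqrt_le_iff.2 ⟨by positivity, ?_⟩
        rw [mul_pow, div_pow, Real.sq_sqrt hS, ← mul_div_assoc]
        gcongr
        · norm_num
        · nlinarith
    _ ≤ _ := by
        rw [← mul_assoc]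
        gcongr
        · exact div_nonneg (Real.sqrt_nonneg _) (by linarith)
        · linarith

/-- The first-order term of the expansion in the variance integrates to zero, so only the
variance of `∑ θ_k² a_k` remains. -/
theorem abs_integral_gaussianReal_real_Iic_sub_le [IsProbabilityMeasure P] (hn : n ≠ 0)
    (hθ : Measurable θ) (hlaw : P.map θ = uniformSphere n) (ha : ∑ k, a k = n) (t : ℝ) :
    |∫ ω, (gaussianReal 0 (∑ k, θ ω k ^ 2 * a k).toNNReal).real (Set.Iic t) ∂P -
      (gaussianReal 0 1).real (Set.Iic t)| ≤
        34 * (∑ k, (a k - 1) ^ 2) / (n * (n + 2)) := by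
  have hVm : Measurable fun ω => ∑ k, θ ω k ^ 2 * a k :=
    (Continuous.measurable (by fun_prop : Continuous
      fun x : EuclideanSpace ℝ (Fin n) => ∑ k, x k ^ 2 * a k)).comp hθ
  have hF : Integrable (fun ω =>
      (gaussianReal 0 (∑ k, θ ω k ^ 2 * a k).toNNReal).real (Set.Iic t)) P := by
    refine Integrable.of_bound ((measurable_gaussianReal_real_Iic t).comp hVm).aestronglyMeasurable
      1 (Filter.Eventually.of_forall fun ω => ?_)
    rw [Real.norm_eq_abs, abs_of_nonneg measureReal_nonneg]
    exact measureReal_le_one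
  have hL : Integrable (fun ω => stdNormalPDF t * t / 2 * (∑ k, θ ω k ^ 2 * a k - 1)) P :=
    integrable_comp_uniformDirection
      (f := fun x => stdNormalPDF t * t / 2 * (∑ k, x k ^ 2 * a k - 1)) hn hθ hlaw (by fun_prop)
  have hQ : Integrable (fun ω => 17 * (∑ k, θ ω k ^ 2 * a k - 1) ^ 2) P :=
    integrable_comp_uniformDirection
      (f := fun x => 17 * (∑ k, x k ^ 2 * a k - 1) ^ 2) hn hθ hlaw (by fun_prop)
  have hc : Integrable (fun _ : Ω => (gaussianReal 0 1).real (Set.Iic t)) P := integrable_const _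
  have h : ∫ ω, (gaussianReal 0 (∑ k, θ ω k ^ 2 * a k).toNNReal).real (Set.Iic t) ∂P -
      (gaussianReal 0 1).real (Set.Iic t) =
      ∫ ω, ((gaussianReal 0 (∑ k, θ ω k ^ 2 * a k).toNNReal).real (Set.Iic t) -
        (gaussianReal 0 1).real (Set.Iic t) +
          stdNormalPDF t * t / 2 * (∑ k, θ ω k ^ 2 * a k - 1)) ∂P := by
    have hFc : Integrable (fun ω =>
        (gaussianReal 0 (∑ k, θ ω k ^ 2 * a k).toNNReal).real (Set.Iic t) -
          (gaussianReal 0 1).real (Set.Iic t)) P := hF.sub hc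
    rw [integral_add hFc hL, integral_sub hF hc, integral_const_mul,
      integral_sum_sq_mul_sub_one hn hθ hlaw ha]
    simp
  rw [h]
  calc _ ≤ ∫ ω, |(gaussianReal 0 (∑ k, θ ω k ^ 2 * a k).toNNReal).real (Set.Iic t) -
        (gaussianReal 0 1).real (Set.Iic t) +
          stdNormalPDF t * t / 2 * (∑ k, θ ω k ^ 2 * a k - 1)| ∂P := abs_integral_le_integral_abs
    _ ≤ ∫ ω, 17 * (∑ k, θ ω k ^ 2 * a k - 1) ^ 2 ∂P :=
        integral_mono ((hF.sub hc).add hL).abs hQ fun ω =>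
          abs_gaussianReal_real_Iic_sub_taylor_le _ t
    _ = _ := by
        rw [integral_const_mul, integral_sum_sq_mul_sub_one_sq hn hθ hlaw ha]
        ring

end RandomDirection

/-! ### Second and fourth moments of the differences -/

theorem integral_sq_sq_le_integral_pow_four {Ω : Type*} {mΩ : MeasurableSpace Ω} {P : Measure Ω}
    [IsProbabilityMeasure P] {X : Ω → ℝ} (hX : MemLp X 4 P) :
    (∫ ω, X ω ^ 2 ∂P) ^ 2 ≤ ∫ ω, X ω ^ 4 ∂P := by
  have h4 : Integrable (fun ω => X ω ^ 4) P := by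
    have := hX.integrable_norm_pow (p := 4) (by norm_num)
    refine this.congr (Filter.Eventually.of_forall fun ω => ?_)
    simp only [Real.norm_eq_abs]
    exact Even.pow_abs (by decide) _
  have h2 : MemLp (fun ω => X ω ^ 2) 2 P := by
    have hXm := hX.aestronglyMeasurable
    rw [memLp_two_iff_integrable_sq (by fun_prop)]
    simpa only [← pow_mul] using h4
  have h := variance_nonneg (fun ω => X ω ^ 2) P
  rw [variance_eq_sub h2] at h
  simp only [Pi.pow_apply, ← pow_mul] at h
  linarith

theorem sum_sub_one_sq_le_mul_maxFourthMoment {Ω : Type*} {mΩ : MeasurableSpace Ω} {P : Measure Ω}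
    [IsProbabilityMeasure P] {n : ℕ} {d : Fin n → Ω → ℝ} (hd : ∀ k, MemLp (d k) 4 P)
    (hsum : ∑ k, ∫ ω, d k ω ^ 2 ∂P = n) :
    ∑ k, (∫ ω, d k ω ^ 2 ∂P - 1) ^ 2 ≤ n * maxFourthMoment d P := by
  have h : ∀ k, (∫ ω, d k ω ^ 2 ∂P) ^ 2 ≤ maxFourthMoment d P := fun k =>
    (integral_sq_sq_le_integral_pow_four (hd k)).trans
      (le_ciSup (f := fun k => ∫ ω, d k ω ^ 4 ∂P) (Set.finite_range _).bddAbove k)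
  calc _ = ∑ k, (∫ ω, d k ω ^ 2 ∂P) ^ 2 - n := by
        simp_rw [sub_sq, Finset.sum_add_distrib, Finset.sum_sub_distrib, mul_one, one_pow,
          ← Finset.mul_sum, hsum]
        simp
        ring
    _ ≤ ∑ k, (∫ ω, d k ω ^ 2 ∂P) ^ 2 := by simp
    _ ≤ ∑ _k : Fin n, maxFourthMoment d P := Finset.sum_le_sum fun k _ => h k
    _ = _ := by simp

/-! ### Normal approximation bounds -/

theorem mainTheorem3 :
    ∃ C : ℝ, 0 < C ∧
      ∀ (n : ℕ) (_ : 2 ≤ n) (Ω : Type*) (mΩ : MeasurableSpace Ω)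
        (P : Measure Ω) (_ : IsProbabilityMeasure P)
        (ℱ : Filtration (Fin (n + 1)) mΩ) (d : Fin n → Ω → ℝ)
        (θ : Ω → EuclideanSpace ℝ (Fin n)) (Nθ : Ω → ℝ),
        IsNormalizedMartingaleDifference d ℱ P →
        IsUniformDirection θ ℱ P →
        IsConditionallyGaussian Nθ θ d P →
        (Integrable
            (fun ω => kolmogorovDist (condDistrib Nθ θ P (θ ω)) (gaussianReal 0 1)) P ∧
          ∫ ω, kolmogorovDist (condDistrib Nθ θ P (θ ω)) (gaussianReal 0 1) ∂P ≤
            35 * Real.sqrt 5 / 4 *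
              (Real.sqrt (∑ k, (∫ ω, d k ω ^ 2 ∂P - 1) ^ 2) / ((n : ℝ) - 1))) ∧
        ((∀ k, MemLp (d k) 4 P) →
          (⨆ t : ℝ, |∫ ω, (condDistrib Nθ θ P (θ ω)).real (Set.Iic t) ∂P -
              (gaussianReal 0 1).real (Set.Iic t)|) ≤
            C * ((1 + maxFourthMoment d P * Real.log n ^ 2) / n)) := by
  refine ⟨102, by norm_num, fun n hn Ω mΩ P hP ℱ d θ Nθ hd hθ hN => ⟨?_, fun hd4 => ?_⟩⟩
  · obtain ⟨hI, hle⟩ := integral_kolmogorovDist_gaussianReal_le hn hθ.measurable hθ.law hd.sum_sq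
    have hae : (fun ω => kolmogorovDist (condDistrib Nθ θ P (θ ω)) (gaussianReal 0 1)) =ᵐ[P]
        fun ω => kolmogorovDist (gaussianReal 0 (∑ k, θ ω k ^ 2 * ∫ ω', d k ω' ^ 2 ∂P).toNNReal)
          (gaussianReal 0 1) := by
      filter_upwards [hN.condDistrib_eq] with ω hω
      rw [hω]
    exact ⟨hI.congr hae.symm, (integral_congr_ae hae).trans_le hle⟩
  · refine ciSup_le fun t => ?_
    have hae : (fun ω => (condDistrib Nθ θ P (θ ω)).real (Set.Iic t)) =ᵐ[P] fun ω =>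
        (gaussianReal 0 (∑ k, θ ω k ^ 2 * ∫ ω', d k ω' ^ 2 ∂P).toNNReal).real (Set.Iic t) := by
      filter_upwards [hN.condDistrib_eq] with ω hω
      rw [hω]
    rw [integral_congr_ae hae]
    have hn0 : (0 : ℝ) < n := by exact_mod_cast (by omega : 0 < n)
    have hα : 0 ≤ maxFourthMoment d P :=
      Real.iSup_nonneg fun k => integral_nonneg fun ω => by positivity
    -- `(log n)² ≥ (log 2)² ≥ 1/3` absorbs the logarithm into the constant
    have hlog : 1 / 3 ≤ Real.log n ^ 2 := by
      have h1 : Real.log 2 ≤ Real.log n := Real.log_le_log two_pos (by exact_mod_cast hn)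
      nlinarith [Real.log_two_gt_d9]
    refine (abs_integral_gaussianReal_real_Iic_sub_le (by omega) hθ.measurable hθ.law
      hd.sum_sq t).trans ?_
    calc _ ≤ 34 * (n * maxFourthMoment d P) / (n * n) := by
          have := sum_sub_one_sq_le_mul_maxFourthMoment hd4 hd.sum_sq
          gcongr
          linarith
      _ = 102 * (maxFourthMoment d P * (1 / 3) / n) := by field_simp; ring
      _ ≤ _ := by
          gcongr
          nlinarith [mul_le_mul_of_nonneg_left hlog hα]
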